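/- All $C^*$-algebras are complex and unital, and all $*$-homomorphisms (in particular all embeddings and representations on Hilbert spaces) are unital. Let $\mathcal U$ be an ultrafilter on a set $I$ that is not closed under countable intersections (for example, a free ultrafilter on $\mathbb N$). In the ultrapower nonstandard universe over $\mathcal U$, a hyperfinite dimensional internal $C^*$-algebra $\mathfrak B$ is given by a family $(B_i)_{i\in I}$ of finite dimensional $C^*$-algebras. Its infinitesimal hull is the $C^*$-algebra $$\widehat{\mathfrak B}=\{(x_i)\in\textstyle\prod_i B_i:\ (\|x_i\|)_i \text{ is bounded on some set of }\mathcal U\}\big/\{(x_i):\ \lim_{\mathcal U}\|x_i\|=0\},\qquad \|[(x_i)]\|=\lim_{\mathcal U}\|x_i\|,$$ that is, the ultraproduct of the $B_i$ along $\mathcal U$. A $C^*$-algebra $A$ is called subhyperfinite if there is an injective unital $*$-homomorphism $A\to\widehat{\mathfrak B}$ for some hyperfinite dimensional $\mathfrak B$. A $C^*$-algebra $A$ is called nuclear if its identity map is a point-norm limit of completely positive contractions of the form $A\xrightarrow{\psi}C\xrightarrow{\rho}A$ with $C$ a finite dimensional $C^*$-algebra and $\psi,\rho$ completely positive contractions.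 For a closed subspace $K$ of a Hilbert space $H$ and a bounded operator $T$ on $H$, let $\mathrm{proj}_K$ be the orthogonal projection onto $K$, and let $\mathrm{compr}_K T=\mathrm{proj}_K T|_K$, an operator on $K$. **Proposition.** Let $A$ be a separable $C^*$-algebra, and consider the condition (∗) for every $\varepsilon>0$ and every finite set $x_1,\dots,x_n\in A$ there are a representation $\varphi$ of $A$ on a Hilbert space $H_\varphi$ and a finite dimensional subspace $K\subseteq H_\varphi$ such that, for all $i\le n$, $$\|x_i\|-\varepsilon\le\|\mathrm{compr}_K\,\varphi(x_i)\|\qquad\text{and}\qquad\|[\varphi(x_i),\mathrm{proj}_K]\|\le\varepsilon .$$ If $A$ is nuclear, then $A$ is subhyperfinite if and only if (∗) holds. Moreover, (∗) implies that $A$ is subhyperfinite without the assumption that $A$ is nuclear. -/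

import Mathlib

open Filter Topology
open scoped CStarAlgebra

universe u v

noncomputable section

namespace Subhyperfinite

/-! ### The infinitesimal hull of an internal C*-algebra

`U` is an ultrafilter on `ι`. In the ultrapower nonstandard universe given by `U`, an internal
C*-algebra `𝔅` is given by a family `B i` of C*-algebras, and an internal element of `𝔅` by a
family `x i ∈ B i`, taken up to equality on a set of `U`. The internal norm of `x` is the hyperreal
`[‖x i‖]`. It is limited iff `‖x i‖` is bounded on a set of `U`, and then its standard part is the
limit of `‖x i‖` along `U`. -/

section Hull

variable {ι : Type v} (U : Ultrafilter ι) (B : ι → Type u) [∀ i, CStarAlgebra (B i)]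

/-- Families representing an internal element of limited norm. -/
def limited : StarSubalgebra ℂ (∀ i, B i) where
  carrier := {x | ∃ M : ℝ, ∀ᶠ i in (U : Filter ι), ‖x i‖ ≤ M}
  mul_mem' := by
    rintro x y ⟨M, hM⟩ ⟨N, hN⟩
    refine ⟨M * N, ?_⟩
    filter_upwards [hM, hN] with i h1 h2
    exact (norm_mul_le _ _).trans
      (mul_le_mul h1 h2 (norm_nonneg _) ((norm_nonneg _).trans h1))
  add_mem' := by
    rintro x y ⟨M, hM⟩ ⟨N, hN⟩
    refine ⟨M + N, ?_⟩
    filter_upwards [hM, hN] with i h1 h2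
    exact (norm_add_le _ _).trans (add_le_add h1 h2)
  algebraMap_mem' := by
    intro r
    refine ⟨‖r‖, Eventually.of_forall fun i => ?_⟩
    rcases subsingleton_or_nontrivial (B i) with h | h
    · rw [Subsingleton.elim (algebraMap ℂ (∀ i, B i) r i) 0, norm_zero]
      exact norm_nonneg r
    · exact (norm_algebraMap' (B i) r).le
  star_mem' := by
    rintro x ⟨M, hM⟩
    exact ⟨M, by simpa using hM⟩

/-- `Fin(𝔅)`, a complex *-algebra. (A separate type, so that it does not carry the product
topology.) -/
def FinPart : Type (max u v) := limited U B

instance : Ring (FinPart U B) := inferInstanceAs (Ring (limited U B))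
instance : StarRing (FinPart U B) := inferInstanceAs (StarRing (limited U B))
instance : Algebra ℂ (FinPart U B) := inferInstanceAs (Algebra ℂ (limited U B))
instance : StarModule ℂ (FinPart U B) := inferInstanceAs (StarModule ℂ (limited U B))

variable {U B}

/-- The `i`-th member of a representing family. -/
def FinPart.coord (x : FinPart U B) (i : ι) : B i := x.1 i

/-- The element of `Fin(𝔅)` given by a family that is bounded on a set of `U`. -/
def FinPart.of (x : ∀ i, B i) (hx : ∃ M : ℝ, ∀ᶠ i in (U : Filter ι), ‖x i‖ ≤ M) : FinPart U B :=
  ⟨x, hx⟩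

theorem FinPart.bounded (x : FinPart U B) :
    ∃ M : ℝ, ∀ᶠ i in (U : Filter ι), ‖x.coord i‖ ≤ M := x.2

@[simp] theorem FinPart.coord_of (x : ∀ i, B i)
    (hx : ∃ M : ℝ, ∀ᶠ i in (U : Filter ι), ‖x i‖ ≤ M) (i : ι) :
    (FinPart.of x hx).coord i = x i := rfl
@[simp] theorem FinPart.coord_zero (i : ι) : (0 : FinPart U B).coord i = 0 := rfl
@[simp] theorem FinPart.coord_one (i : ι) : (1 : FinPart U B).coord i = 1 := rfl
@[simp] theorem FinPart.coord_add (x y : FinPart U B) (i : ι) :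
    (x + y).coord i = x.coord i + y.coord i := rfl
@[simp] theorem FinPart.coord_neg (x : FinPart U B) (i : ι) :
    (-x).coord i = -x.coord i := rfl
@[simp] theorem FinPart.coord_sub (x y : FinPart U B) (i : ι) :
    (x - y).coord i = x.coord i - y.coord i := rfl
@[simp] theorem FinPart.coord_mul (x y : FinPart U B) (i : ι) :
    (x * y).coord i = x.coord i * y.coord i := rfl
@[simp] theorem FinPart.coord_star (x : FinPart U B) (i : ι) :
    (star x).coord i = star (x.coord i) := rfl
@[simp] theorem FinPart.coord_smul (c : ℂ) (x : FinPart U B) (i : ι) :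
    (c • x).coord i = c • x.coord i := rfl

theorem FinPart.coord_sum (u : ℕ → FinPart U B) (n : ℕ) (i : ι) :
    (∑ k ∈ Finset.range n, u k).coord i = ∑ k ∈ Finset.range n, (u k).coord i := by
  induction n with
  | zero => simp
  | succ n ih => simp [Finset.sum_range_succ, ih]

/-- The seminorm `st ‖x‖` on `Fin(𝔅)`. -/
instance : Norm (FinPart U B) := ⟨fun x => limUnder (U : Filter ι) fun i => ‖x.coord i‖⟩

/-- The limit along `U` defining the seminorm exists. -/
theorem FinPart.tendsto_norm (x : FinPart U B) :
    Tendsto (fun i => ‖x.coord i‖) (U : Filter ι) (𝓝 ‖x‖) := by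
  obtain ⟨M, hM⟩ := x.bounded
  have hc : IsCompact (Set.Icc (0 : ℝ) M) := isCompact_Icc
  have hle : ((U.map fun i => ‖x.coord i‖ : Ultrafilter ℝ) : Filter ℝ) ≤
      𝓟 (Set.Icc (0 : ℝ) M) := by
    rw [le_principal_iff, Ultrafilter.coe_map, mem_map]
    filter_upwards [hM] with i hi
    exact ⟨norm_nonneg _, hi⟩
  obtain ⟨a, -, ha⟩ := hc.ultrafilter_le_nhds _ hle
  exact tendsto_nhds_limUnder ⟨a, by simpa [Tendsto] using ha⟩

theorem FinPart.norm_le_of_eventually {x : FinPart U B} {M : ℝ}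
    (h : ∀ᶠ i in (U : Filter ι), ‖x.coord i‖ ≤ M) : ‖x‖ ≤ M :=
  le_of_tendsto x.tendsto_norm h

instance : SeminormedRing (FinPart U B) :=
  { (inferInstance : Ring (FinPart U B)),
    SeminormedAddCommGroup.ofCore (𝕜 := ℂ) (E := FinPart U B)
      { norm_nonneg := fun x =>
          ge_of_tendsto x.tendsto_norm (Eventually.of_forall fun _ => norm_nonneg _)
        norm_smul := fun c x => by
          refine tendsto_nhds_unique (c • x).tendsto_norm ?_
          simpa [norm_smul] using x.tendsto_norm.const_mul ‖c‖
        norm_triangle := fun x y =>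
          le_of_tendsto_of_tendsto (x + y).tendsto_norm (x.tendsto_norm.add y.tendsto_norm)
            (Eventually.of_forall fun _ => norm_add_le _ _) } with
    norm_mul_le := fun x y =>
      le_of_tendsto_of_tendsto (x * y).tendsto_norm (x.tendsto_norm.mul y.tendsto_norm)
        (Eventually.of_forall fun _ => norm_mul_le _ _) }

instance : NormedAlgebra ℂ (FinPart U B) where
  norm_smul_le c x := by
    refine (tendsto_nhds_unique (c • x).tendsto_norm ?_).le
    simpa [norm_smul] using x.tendsto_norm.const_mul ‖c‖

theorem FinPart.norm_star (x : FinPart U B) : ‖star x‖ = ‖x‖ := by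
  refine tendsto_nhds_unique (star x).tendsto_norm ?_
  simpa using x.tendsto_norm

theorem FinPart.norm_star_mul_self (x : FinPart U B) : ‖star x * x‖ = ‖x‖ * ‖x‖ := by
  refine tendsto_nhds_unique (star x * x).tendsto_norm ?_
  simpa [CStarRing.norm_star_mul_self] using x.tendsto_norm.mul x.tendsto_norm

theorem FinPart.continuous_star : Continuous (star : FinPart U B → FinPart U B) :=
  (AddMonoidHomClass.isometry_of_norm (starAddEquiv (R := FinPart U B))
    FinPart.norm_star).continuous

variable (U B)

/-- The infinitesimal hull of `𝔅`: the quotient of `Fin(𝔅)` by the elements of infinitesimal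
norm. Equivalently, the ultraproduct of the family `B` along `U`. -/
abbrev Hull : Type (max u v) := SeparationQuotient (FinPart U B)

instance : StarRing (Hull U B) where
  star := SeparationQuotient.lift (fun x => SeparationQuotient.mk (star x)) fun x y h =>
    SeparationQuotient.mk_eq_mk.2 (h.map FinPart.continuous_star)
  star_involutive := by
    intro x
    obtain ⟨x, rfl⟩ := SeparationQuotient.surjective_mk x
    exact congrArg SeparationQuotient.mk (star_star _)
  star_mul := by
    intro x y
    obtain ⟨x, rfl⟩ := SeparationQuotient.surjective_mk x
    obtain ⟨y, rfl⟩ := SeparationQuotient.surjective_mk y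
    exact congrArg SeparationQuotient.mk (star_mul _ _)
  star_add := by
    intro x y
    obtain ⟨x, rfl⟩ := SeparationQuotient.surjective_mk x
    obtain ⟨y, rfl⟩ := SeparationQuotient.surjective_mk y
    exact congrArg SeparationQuotient.mk (star_add _ _)

instance : CompleteSpace (Hull U B) := by
  refine NormedAddCommGroup.completeSpace_of_summable_imp_tendsto fun u hu => ?_
  choose w hw using fun n => SeparationQuotient.surjective_mk (u n)
  have hwn : ∀ n, ‖w n‖ = ‖u n‖ := fun n => by rw [← hw n, SeparationQuotient.norm_mk]
  obtain ⟨c, hc⟩ : ∃ c : ℕ → ℝ, c = fun n => ‖w n‖ + (1 / 2 : ℝ) ^ n := ⟨_, rfl⟩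
  have hcs : Summable c := by
    rw [hc]
    simp only [hwn]
    exact hu.add summable_geometric_two
  have hc0 : ∀ n, 0 ≤ c n := fun n => by
    rw [hc]
    positivity
  -- uniformly bounded representatives
  have hrep : ∀ n, ∃ v : ∀ i, B i, (∀ i, ‖v i‖ ≤ c n) ∧
      ∀ᶠ i in (U : Filter ι), v i = (w n).coord i := by
    intro n
    classical
    refine ⟨fun i => if ‖(w n).coord i‖ ≤ c n then (w n).coord i else 0, fun i => ?_, ?_⟩
    · dsimp only
      split_ifs with h
      · exact h
      · simpa using hc0 n
    · have hlt : ‖w n‖ < c n := by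
        rw [hc]
        exact lt_add_of_pos_right _ (by positivity)
      filter_upwards [(w n).tendsto_norm.eventually (gt_mem_nhds hlt)] with i hi
      exact if_pos hi.le
  choose v hvc hvw using hrep
  have hvs : ∀ i, Summable fun n => ‖v n i‖ := fun i =>
    Summable.of_nonneg_of_le (fun _ => norm_nonneg _) (fun n => hvc n i) hcs
  have htail : ∀ n i, ‖(∑' k, v k i) - ∑ k ∈ Finset.range n, v k i‖ ≤ ∑' k, c (k + n) := by
    intro n i
    have h1 : (∑' k, v k i) - ∑ k ∈ Finset.range n, v k i = ∑' k, v (k + n) i := by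
      rw [← (hvs i).of_norm.sum_add_tsum_nat_add n]
      simp
    rw [h1]
    exact tsum_of_norm_bounded ((summable_nat_add_iff n).2 hcs).hasSum fun k => hvc (k + n) i
  let a : FinPart U B := FinPart.of (fun i => ∑' k, v k i)
    ⟨∑' k, c k, Eventually.of_forall fun i => by simpa using htail 0 i⟩
  refine ⟨SeparationQuotient.mk a, ?_⟩
  rw [tendsto_iff_norm_sub_tendsto_zero]
  refine squeeze_zero (fun _ => norm_nonneg _) (fun n => ?_) (tendsto_sum_nat_add c)
  have h2 : ∑ k ∈ Finset.range n, u k = SeparationQuotient.mk (∑ k ∈ Finset.range n, w k) := by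
    simp only [← hw]
    exact (map_sum (SeparationQuotient.mkAddMonoidHom (M := FinPart U B)) w _).symm
  rw [h2, norm_sub_rev, ← SeparationQuotient.mk_sub, SeparationQuotient.norm_mk]
  refine FinPart.norm_le_of_eventually ?_
  filter_upwards [(eventually_all_finset (Finset.range n)).2 fun k _ => hvw k] with i hi
  rw [FinPart.coord_sub, FinPart.coord_sum, ← Finset.sum_congr rfl hi]
  exact htail n i

/-- The infinitesimal hull is a C*-algebra. -/
instance : CStarAlgebra (Hull U B) where
  norm_mul_self_le := by
    intro x
    obtain ⟨x, rfl⟩ := SeparationQuotient.surjective_mk x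
    exact (FinPart.norm_star_mul_self x).ge
  star_smul := by
    intro c x
    obtain ⟨x, rfl⟩ := SeparationQuotient.surjective_mk x
    exact congrArg SeparationQuotient.mk (star_smul _ _)

end Hull

/-- `A` is subhyperfinite (in the nonstandard universe given by `U`) if it embeds, by an injective
unital *-homomorphism, in the infinitesimal hull of a hyperfinite dimensional internal
C*-algebra. -/
def IsSubhyperfinite {ι : Type v} (U : Ultrafilter ι) (A : Type u) [CStarAlgebra A] : Prop :=
  ∃ (B : ι → Type u) (_ : ∀ i, CStarAlgebra (B i)) (_ : ∀ i, FiniteDimensional ℂ (B i))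
    (f : A →⋆ₐ[ℂ] Hull U B), Function.Injective f

/-! ### Nuclearity -/

section Nuclear

variable {A B : Type u} [CStarAlgebra A] [PartialOrder A] [StarOrderedRing A]
  [CStarAlgebra B] [PartialOrder B] [StarOrderedRing B]

/-- A completely positive map is matricial if it factors, by completely positive contractions,
through a finite dimensional C*-algebra. -/
def IsMatricial (φ : A →CP B) : Prop :=
  ∃ (C : Type u) (_ : CStarAlgebra C) (_ : PartialOrder C) (_ : StarOrderedRing C)
    (_ : FiniteDimensional ℂ C) (ψ : A →CP C) (ρ : C →CP B),
    (∀ x, ‖ψ x‖ ≤ ‖x‖) ∧ (∀ c, ‖ρ c‖ ≤ ‖c‖) ∧ ∀ x, φ x = ρ (ψ x)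

/-- A completely positive contraction is nuclear if it is a limit of matricial completely positive
contractions in the point-norm topology. (For separable `A` this is the same as being the limit of
a sequence of such maps.) -/
def IsNuclearMap (φ : A →CP B) : Prop :=
  (∀ x, ‖φ x‖ ≤ ‖x‖) ∧
    ∀ (F : Finset A) (ε : ℝ), 0 < ε → ∃ θ : A →CP B, IsMatricial θ ∧ ∀ x ∈ F, ‖θ x - φ x‖ ≤ ε

variable (A) in
/-- The identity map, as a completely positive map. -/
def cpId : A →CP A where
  toLinearMap := LinearMap.id
  map_cstarMatrix_nonneg' _ _ hM := hM

variable (A) in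
/-- A C*-algebra is nuclear if its identity map is nuclear. -/
def IsNuclear : Prop := IsNuclearMap (cpId A)

end Nuclear

/-! ### The condition on compressions -/

/-- The compression of `T` to `K`, an operator on `K`. -/
def compression {H : Type u} [NormedAddCommGroup H] [InnerProductSpace ℂ H]
    (K : Submodule ℂ H) [K.HasOrthogonalProjection] (T : H →L[ℂ] H) : K →L[ℂ] K :=
  K.orthogonalProjectionOnto ∘L T ∘L K.subtypeL

/-- For every `ε > 0` and finite `F ⊆ A` there are a (unital) representation `φ` of `A` on a
Hilbert space `H` and a finite dimensional subspace `K` of `H` such that, for all `x ∈ F`,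
`‖x‖ - ε ≤ ‖compr_K φ(x)‖` and `‖[φ(x), proj_K]‖ ≤ ε`. -/
def HasAlmostCommutingCompressions (A : Type u) [CStarAlgebra A] : Prop :=
  ∀ (ε : ℝ), 0 < ε → ∀ F : Finset A,
    ∃ (H : Type u) (_ : NormedAddCommGroup H) (_ : InnerProductSpace ℂ H) (_ : CompleteSpace H)
      (φ : A →⋆ₐ[ℂ] (H →L[ℂ] H)) (K : Submodule ℂ H) (_ : FiniteDimensional ℂ K),
      ∀ x ∈ F, ‖x‖ - ε ≤ ‖compression K (φ x)‖ ∧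
        ‖φ x * K.starProjection - K.starProjection * φ x‖ ≤ ε

end Subhyperfinite

end

/-! From (∗) to an embedding: if the projection `P` onto `K` almost commutes with `φ y`, then `x ↦
compr_K (φ x)` is almost multiplicative against `y`. It is also unital, contractive and
star-preserving, with values in the finite dimensional algebra of operators on `K`. Take such maps
with error `1/(n+1)` on the first `n` terms of a dense sequence, and use stage `ν i` at index `i`,
where `ν` tends to infinity along `U`. Such a `ν` exists because `U` is not closed under countable
intersections. In the hull the errors vanish and the norms survive.

From nuclearity and an embedding `f` to (∗): a factorization `ρ ∘ ψ` close to the identity has to be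
moved into a single `B i` without losing complete positivity. For this, `ρ (ψ a)` is written as a
finite sum of `g k l a • (star (y m k) * y m l)`, where `g` is a completely positive matrix of
functionals and the `y m k` are elements of `A` (`IsNuclear.exists_schurMap`). Such a sum is
completely positive for every choice of `y`. So the `f (y m k)` can be lifted arbitrarily to
families, and every coordinate gives a completely positive map `θ` from `A` to `B i`. For a suitable
`i` it is almost unital, almost multiplicative and almost isometric on the given finite set.

Represent `B i` faithfully on a finite dimensional `L` and dilate `θ` to `φ` with `θ a = V* φ(a) V`.
Expanding `‖φ x V ξ - V (θ x) ξ‖²` shows that it is governed by `multDefect θ x`. Hence `K = V L` is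
almost invariant under `φ x` and `φ (star x)`, so its projection almost commutes with `φ x`. -/

namespace Subhyperfinite

open scoped ComplexOrder InnerProductSpace

/-- The trace of the left regular representation of a finite dimensional algebra. -/
noncomputable def regularTrace (C : Type*) [Ring C] [Algebra ℂ C] : C →ₗ[ℂ] ℂ :=
  LinearMap.trace ℂ C ∘ₗ (Algebra.lmul ℂ C).toLinearMap

/-! ### The regular trace is a faithful positive trace. -/

section RegularTrace

variable {C : Type*} [CStarAlgebra C]

theorem spectrum_star_mul_self_nonneg' (c : C) {μ : ℂ} (hμ : μ ∈ spectrum ℂ (star c * c)) :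
    0 ≤ μ := by
  let _ := CStarAlgebra.spectralOrder C
  have _ := CStarAlgebra.spectralOrderedRing C
  exact spectrum_nonneg_of_nonneg (star_mul_self_nonneg c) hμ

theorem regularTrace_mul_comm (a b : C) : regularTrace C (a * b) = regularTrace C (b * a) := by
  simp only [regularTrace, LinearMap.comp_apply, AlgHom.toLinearMap_apply, map_mul]
  exact LinearMap.trace_mul_comm ℂ _ _

/-- If left multiplication is bijective, a preimage of `1` is a right inverse, and injectivity makes
it two-sided. -/
theorem spectrum_lmul (b : C) : spectrum ℂ (Algebra.lmul ℂ C b) = spectrum ℂ b := by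
  refine (AlgHom.spectrum_apply_subset (Algebra.lmul ℂ C) b).antisymm fun μ hμ => ?_
  rw [spectrum.mem_iff] at hμ ⊢
  contrapose! hμ
  rw [← (Algebra.lmul ℂ C).commutes, ← map_sub] at hμ
  obtain ⟨c, hc⟩ := ((Module.End.isUnit_iff _).1 hμ).surjective 1
  have hc' : (algebraMap ℂ C μ - b) * c = 1 := hc
  refine (Units.mk _ c hc' (((Module.End.isUnit_iff _).1 hμ).injective ?_)).isUnit
  change (algebraMap ℂ C μ - b) * (c * (algebraMap ℂ C μ - b)) = (algebraMap ℂ C μ - b) * 1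
  rw [← mul_assoc, hc', one_mul, mul_one]

variable [FiniteDimensional ℂ C]

theorem regularTrace_eq_sum_roots (b : C) :
    regularTrace C b = (Algebra.lmul ℂ C b).charpoly.roots.sum :=
  Module.End.trace_eq_sum_roots_charpoly_of_splits (IsAlgClosed.splits _)

theorem mem_roots_charpoly_lmul (b : C) (μ : ℂ) :
    μ ∈ (Algebra.lmul ℂ C b).charpoly.roots ↔ μ ∈ spectrum ℂ b := by
  rw [← spectrum_lmul, Module.End.mem_spectrum_iff_isRoot_charpoly, Polynomial.mem_roots]
  exact (LinearMap.charpoly_monic _).ne_zero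

/-- The trace is the sum of the eigenvalues of left multiplication, and these are the points of the
spectrum of `star c * c`. -/
theorem regularTrace_star_mul_self_nonneg (c : C) : 0 ≤ regularTrace C (star c * c) := by
  rw [regularTrace_eq_sum_roots]
  refine Multiset.sum_nonneg fun μ hμ => ?_
  exact spectrum_star_mul_self_nonneg' c ((mem_roots_charpoly_lmul _ _).1 hμ)

theorem eq_zero_of_regularTrace_star_mul_self (c : C) (h : regularTrace C (star c * c) = 0) :
    c = 0 := by
  rw [regularTrace_eq_sum_roots] at h
  have h0 := Multiset.all_zero_of_le_zero_le_of_sum_eq_zero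
    (fun μ hμ => spectrum_star_mul_self_nonneg' c ((mem_roots_charpoly_lmul _ μ).1 hμ)) h
  rw [← CStarRing.star_mul_self_eq_zero_iff]
  refine CFC.eq_zero_of_spectrum_subset_zero (R := ℂ) (p := IsStarNormal) _ (fun μ hμ => ?_) ?_
  · exact h0 μ ((mem_roots_charpoly_lmul _ _).2 hμ)
  · exact (IsSelfAdjoint.star_mul_self c).isStarNormal

variable (C) in
/-- The regular trace, as a positive functional. -/
noncomputable def regularTracePos [PartialOrder C] [StarOrderedRing C] : C →ₚ[ℂ] ℂ :=
  .mk₀ (regularTrace C) fun x hx => by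
    obtain ⟨c, rfl⟩ := CStarAlgebra.nonneg_iff_eq_star_mul_self.1 hx
    exact regularTrace_star_mul_self_nonneg c

theorem star_regularTrace (a : C) : star (regularTrace C a) = regularTrace C (star a) := by
  let _ := CStarAlgebra.spectralOrder C
  have _ := CStarAlgebra.spectralOrderedRing C
  exact (map_star (regularTracePos C) a).symm

end RegularTrace

/-- The space carries no norm here, so that the Hilbert norm from the core does not clash with the
C*-norm when `V` is a C*-algebra. -/
theorem exists_orthonormal_expansion {V : Type*} [AddCommGroup V] [Module ℂ V]
    [FiniteDimensional ℂ V] (core : InnerProductSpace.Core ℂ V) :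
    ∃ c : Fin (Module.finrank ℂ V) → V, (∀ y, ∑ k, core.inner (c k) y • c k = y) ∧
      ∀ T : V →ₗ[ℂ] V, LinearMap.trace ℂ V T = ∑ k, core.inner (c k) (T (c k)) := by
  let : NormedAddCommGroup V := core.toNormedAddCommGroup
  let : InnerProductSpace ℂ V := InnerProductSpace.ofCore core.toCore
  let b := stdOrthonormalBasis ℂ V
  exact ⟨b, fun y => b.sum_repr' y, fun T => LinearMap.trace_eq_sum_inner T b⟩

/-! ### Trace-orthonormal frames and a finite dimensional representation. -/

section Frame

variable (C : Type*) [CStarAlgebra C] [FiniteDimensional ℂ C]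

/-- The inner product given by the regular trace. -/
@[reducible] noncomputable def regularTraceCore : InnerProductSpace.Core ℂ C where
  inner a b := regularTrace C (star a * b)
  conj_inner_symm a b := by
    rw [← Complex.star_def, star_regularTrace]
    simp
  re_inner_nonneg a := (Complex.nonneg_iff.1 (regularTrace_star_mul_self_nonneg a)).1
  add_left a b c := by simp [add_mul]
  smul_left a b r := by simp
  definite a h := eq_zero_of_regularTrace_star_mul_self a h

/-- A finite dimensional C*-algebra has a basis, orthonormal for the regular trace, that is also
a Parseval frame for the algebra as a Hilbert module over itself. -/
theorem exists_regularTrace_frame : ∃ (n : ℕ) (c : Fin n → C),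
    (∀ y, ∑ k, regularTrace C (star (c k) * y) • c k = y) ∧ ∑ k, c k * star (c k) = 1 := by
  obtain ⟨c, hc, ht⟩ := exists_orthonormal_expansion (regularTraceCore C)
  refine ⟨_, c, hc, ?_⟩
  rw [← sub_eq_zero]
  obtain ⟨z, hz⟩ : ∃ z, z = ∑ k, c k * star (c k) - 1 := ⟨_, rfl⟩
  rw [← hz]
  refine eq_zero_of_regularTrace_star_mul_self z ?_
  -- By traciality the left side is `∑ τ(star (c k) * y * c k)`, the trace of left multiplication by
  -- `y` computed in the orthonormal basis. Taking `y = star z` and using faithfulness gives `z =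
  -- 0`.
  have key : ∀ y, regularTrace C (y * ∑ k, c k * star (c k)) = regularTrace C y := by
    intro y
    refine Eq.trans ?_ (ht (Algebra.lmul ℂ C y)).symm
    rw [Finset.mul_sum, map_sum]
    refine Finset.sum_congr rfl fun k _ => ?_
    rw [← mul_assoc, regularTrace_mul_comm]
    rfl
  nth_rewrite 2 [hz]
  rw [mul_sub, map_sub, key, mul_one, sub_self]

end Frame

section FrameExpansion

variable {C : Type*} [CStarAlgebra C]

/-- Write `x = ∑ x * c l * star (c l)` and expand each `x * c l` in the basis. This recovers `x`
from the scalar matrix of its coefficients. -/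
theorem regularTrace_frame_expansion {n : ℕ} {c : Fin n → C}
    (h : ∀ y, ∑ k, regularTrace C (star (c k) * y) • c k = y)
    (h1 : ∑ k, c k * star (c k) = 1) (x : C) :
    ∑ k, ∑ l, regularTrace C (star (c k) * (x * c l)) • (c k * star (c l)) = x := by
  rw [Finset.sum_comm]
  calc _ = ∑ l, (∑ k, regularTrace C (star (c k) * (x * c l)) • c k) * star (c l) := by
        simp only [Finset.sum_mul, smul_mul_assoc]
    _ = ∑ l, x * (c l * star (c l)) := by simp only [h, mul_assoc]
    _ = x := by rw [← Finset.mul_sum, h1, mul_one]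

theorem regularTrace_star_mul_eq_sum {n : ℕ} {c : Fin n → C}
    (h : ∀ y, ∑ k, regularTrace C (star (c k) * y) • c k = y) (a b : C) :
    regularTrace C (star a * b) =
      ∑ k, star (regularTrace C (star (c k) * a)) * regularTrace C (star (c k) * b) := by
  conv_lhs => rw [← h a]
  simp only [star_sum, star_smul, Finset.sum_mul, map_sum, smul_mul_assoc, map_smul, smul_eq_mul]

end FrameExpansion

/-- A finite dimensional C*-algebra is an algebra of operators on a finite dimensional Hilbert
space. -/
theorem exists_faithful_finiteDimensional_rep (B : Type u) [CStarAlgebra B]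
    [FiniteDimensional ℂ B] :
    ∃ (L : Type u) (_ : NormedAddCommGroup L) (_ : InnerProductSpace ℂ L) (_ : CompleteSpace L)
      (_ : FiniteDimensional ℂ L) (π : B →⋆ₐ[ℂ] (L →L[ℂ] L)), ∀ b, ‖π b‖ = ‖b‖ := by
  let _ := CStarAlgebra.spectralOrder B
  have _ := CStarAlgebra.spectralOrderedRing B
  let f := regularTracePos B
  let j : B →ₗ[ℂ] f.GNS :=
    (UniformSpace.Completion.toComplL (𝕜 := ℂ) (E := f.PreGNS)).toLinearMap ∘ₗ
      f.toPreGNS.toLinearMap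
  -- The image of `B` is dense in the completion and, being finite dimensional, closed.
  have hfin : FiniteDimensional ℂ f.GNS := by
    have hd : DenseRange j := by
      have h1 : DenseRange ((↑) : f.PreGNS → f.GNS) := UniformSpace.Completion.denseRange_coe
      exact h1
    have hr : j.range = ⊤ := by
      rw [← (Submodule.closed_of_finiteDimensional j.range).submodule_topologicalClosure_eq]
      exact Submodule.dense_iff_topologicalClosure_eq_top.1 hd
    exact Module.Finite.of_surjective j (LinearMap.range_eq_top.1 hr)
  have hinj : Function.Injective f.gnsStarAlgHom := by
    rw [injective_iff_map_eq_zero]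
    intro b hb
    refine eq_zero_of_regularTrace_star_mul_self b ?_
    have h1 : f.gnsStarAlgHom b (f.toPreGNS 1 : f.PreGNS) = 0 := by
      rw [hb]
      rfl
    have h2 : ((f.toPreGNS b : f.PreGNS) : f.GNS) = 0 := by
      simpa using h1
    have h3 : ‖f.toPreGNS b‖ = 0 := by
      rw [← UniformSpace.Completion.norm_coe, h2, norm_zero]
    have h4 := f.preGNS_norm_sq (f.toPreGNS b)
    rw [h3] at h4
    simp only [Complex.ofReal_zero, ne_eq, OfNat.ofNat_ne_zero, not_false_eq_true, zero_pow] at h4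
    exact h4.symm
  exact ⟨f.GNS, inferInstance, inferInstance, inferInstance, hfin, f.gnsStarAlgHom,
    fun b => NonUnitalStarAlgHom.norm_map f.gnsStarAlgHom hinj b⟩

/-! ### Stinespring dilation by a GNS construction on matrices. -/

section Dilation

variable {A : Type*} [CStarAlgebra A]

variable (A) in
/-- The embedding of `A` in the matrices over `A` as constant diagonal matrices. -/
noncomputable def diagonalStarAlgHom (J : Type*) [Fintype J] [DecidableEq J] :
    A →⋆ₐ[ℂ] CStarMatrix J J A where
  toFun a := CStarMatrix.ofMatrix (Matrix.diagonal fun _ => a)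
  map_one' := rfl
  map_zero' := by
    ext i j
    simp [CStarMatrix.ofMatrix_apply]
  map_add' a b := by
    ext i j
    by_cases h : i = j <;> simp [CStarMatrix.ofMatrix_apply, h]
  map_mul' a b := by
    ext i j
    by_cases h : i = j <;>
      simp [CStarMatrix.ofMatrix_apply, CStarMatrix.mul_apply, Matrix.diagonal_apply, h]
  commutes' r := by
    ext i j
    by_cases h : i = j <;>
      simp [CStarMatrix.ofMatrix_apply, CStarMatrix.algebraMap_apply, h]
  map_star' a := by
    ext i j
    by_cases h : i = j
    · simp [CStarMatrix.ofMatrix_apply, CStarMatrix.star_apply, h]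
    · simp [CStarMatrix.ofMatrix_apply, CStarMatrix.star_apply, h, Ne.symm h]

/-- Matrix units from one fixed row `k`, viewed as GNS vectors, have inner products that single out
the entry `(i, j)`. -/
theorem star_single_mul_diagonal_mul_single {J : Type*} [Fintype J] [DecidableEq J]
    (k i j : J) (a : A) :
    star (CStarMatrix.ofMatrix (Matrix.single k i (1 : A))) *
      (diagonalStarAlgHom A J a * CStarMatrix.ofMatrix (Matrix.single k j (1 : A))) =
      CStarMatrix.ofMatrix (Matrix.single i j a) := by
  ext p q
  have h : ∀ r s, (diagonalStarAlgHom A J a) r s = if r = s then a else 0 := fun r s => by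
    change Matrix.diagonal (fun _ => a) r s = _
    rw [Matrix.diagonal_apply]
  simp only [CStarMatrix.mul_apply, CStarMatrix.star_apply, CStarMatrix.ofMatrix_apply,
    Matrix.single_apply, h]
  by_cases hp : i = p <;> by_cases hq : j = q <;> simp [hp, hq]

/-- Complete positivity of an operator valued map, as positivity of the associated forms. -/
def HasPositiveForms [PartialOrder A] [StarOrderedRing A] {L : Type*} [NormedAddCommGroup L] [InnerProductSpace ℂ L]
    (θ : A →ₗ[ℂ] (L →L[ℂ] L)) : Prop :=
  ∀ (n : ℕ) (M : CStarMatrix (Fin n) (Fin n) A), 0 ≤ M → ∀ ξ : Fin n → L,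
    0 ≤ ∑ i, ∑ j, ⟪ξ i, θ (M i j) (ξ j)⟫_ℂ

/-- Stinespring dilation of a completely positive map to the operators on a finite dimensional
Hilbert space. -/
theorem exists_dilation {A : Type u} [CStarAlgebra A] [PartialOrder A] [StarOrderedRing A]
    {L : Type u} [NormedAddCommGroup L] [InnerProductSpace ℂ L] [FiniteDimensional ℂ L]
    (θ : A →ₗ[ℂ] (L →L[ℂ] L)) (hθ : HasPositiveForms θ) :
    ∃ (H : Type u) (_ : NormedAddCommGroup H) (_ : InnerProductSpace ℂ H) (_ : CompleteSpace H)
      (φ : A →⋆ₐ[ℂ] (H →L[ℂ] H)) (V : L →ₗ[ℂ] H),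
      ∀ a ξ η, ⟪V ξ, φ a (V η)⟫_ℂ = ⟪ξ, θ a η⟫_ℂ := by
  obtain ⟨n, e⟩ : ∃ n, Nonempty (Module.Basis (Fin n) ℂ L) := ⟨_, ⟨Module.finBasis ℂ L⟩⟩
  obtain ⟨e⟩ := e
  -- The extra zero vector guarantees a row `0` even when `L = 0`; the basis vector `e j` sits at
  -- index `j.succ`.
  let ζ : Fin (n + 1) → L := Fin.cons 0 e
  let f₀ : CStarMatrix (Fin (n + 1)) (Fin (n + 1)) A →ₗ[ℂ] ℂ :=
    { toFun := fun M => ∑ i, ∑ j, ⟪ζ i, θ (M i j) (ζ j)⟫_ℂ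
      map_add' := fun M N => by
        simp [Finset.sum_add_distrib]
      map_smul' := fun r M => by
        simp [Finset.mul_sum] }
  let f : CStarMatrix (Fin (n + 1)) (Fin (n + 1)) A →ₚ[ℂ] ℂ :=
    .mk₀ f₀ fun M hM => hθ _ M hM ζ
  let w : Fin (n + 1) → f.GNS := fun j =>
    ((f.toPreGNS (CStarMatrix.ofMatrix (Matrix.single 0 j (1 : A))) : f.PreGNS) : f.GNS)
  let φ : A →⋆ₐ[ℂ] (f.GNS →L[ℂ] f.GNS) :=
    f.gnsStarAlgHom.comp (diagonalStarAlgHom A (Fin (n + 1)))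
  have hw : ∀ a i j, ⟪w i, φ a (w j)⟫_ℂ = ⟪ζ i, θ a (ζ j)⟫_ℂ := by
    intro a i j
    have h1 : φ a (w j) = ((f.toPreGNS (diagonalStarAlgHom A (Fin (n + 1)) a *
        CStarMatrix.ofMatrix (Matrix.single 0 j (1 : A))) : f.PreGNS) : f.GNS) := by
      simp [φ, w]
    rw [h1, UniformSpace.Completion.inner_coe, PositiveLinearMap.preGNS_inner_def]
    simp only [PositiveLinearMap.ofPreGNS_toPreGNS]
    rw [star_single_mul_diagonal_mul_single]
    change ∑ p, ∑ q, ⟪ζ p, θ (Matrix.single i j a p q) (ζ q)⟫_ℂ = _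
    rw [Finset.sum_eq_single i, Finset.sum_eq_single j]
    · simp
    · intro q _ hq
      simp [hq.symm]
    · simp
    · intro p _ hp
      simp [hp.symm]
    · simp
  refine ⟨f.GNS, inferInstance, inferInstance, inferInstance, φ,
    e.constr ℂ fun j => w j.succ, fun a ξ η => ?_⟩
  conv_rhs => rw [← e.sum_repr ξ, ← e.sum_repr η]
  simp only [Module.Basis.constr_apply_fintype, Module.Basis.equivFun_apply, map_sum, map_smul,
    sum_inner, inner_sum, inner_smul_left, inner_smul_right]
  simp only [hw]
  simp [ζ]

end Dilation

/-! ### Almost invariant subspaces and estimates for the dilation. -/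

section Commutator

variable {H : Type*} [NormedAddCommGroup H] [InnerProductSpace ℂ H] [CompleteSpace H]

/-- The commutator is the difference of the off-diagonal corners `(1 - P) T P` and `((1 - P) T*
P)*`, each of norm at most `r`. -/
theorem norm_commutator_starProjection_le (K : Submodule ℂ H) [K.HasOrthogonalProjection]
    (T : H →L[ℂ] H) {r : ℝ} (hr : 0 ≤ r)
    (h1 : ∀ k ∈ K, ‖T k - K.starProjection (T k)‖ ≤ r * ‖k‖)
    (h2 : ∀ k ∈ K, ‖star T k - K.starProjection (star T k)‖ ≤ r * ‖k‖) :
    ‖T * K.starProjection - K.starProjection * T‖ ≤ 2 * r := by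
  obtain ⟨P, hP⟩ : ∃ P, P = K.starProjection := ⟨_, rfl⟩
  have hb : ∀ S : H →L[ℂ] H, (∀ k ∈ K, ‖S k - K.starProjection (S k)‖ ≤ r * ‖k‖) →
      ‖S * P - P * S * P‖ ≤ r := by
    intro S hS
    refine ContinuousLinearMap.opNorm_le_bound _ hr fun x => ?_
    rw [hP]
    exact (hS _ (K.starProjection_apply_mem x)).trans
      (mul_le_mul_of_nonneg_left (K.norm_starProjection_apply_le x) hr)
  have hsa : star P = P := by rw [hP]; exact (isSelfAdjoint_starProjection K).star_eq
  have e : T * P - P * T = (T * P - P * T * P) - star (star T * P - P * star T * P) := by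
    simp only [star_sub, star_mul, star_star, hsa, mul_assoc]
    abel
  rw [← hP, e]
  refine (norm_sub_le _ _).trans ?_
  rw [_root_.norm_star, two_mul]
  exact add_le_add (hb T h1) (hb _ h2)

end Commutator

section Dilation

variable {A : Type*} [CStarAlgebra A]
  {L : Type*} [NormedAddCommGroup L] [InnerProductSpace ℂ L]
  {H : Type*} [NormedAddCommGroup H] [InnerProductSpace ℂ H] [CompleteSpace H]
  {θ : A → (L →L[ℂ] L)} {φ : A →⋆ₐ[ℂ] (H →L[ℂ] H)} {V : L →ₗ[ℂ] H}

/-- The defect of multiplicativity of `θ` at `x`. -/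
noncomputable def multDefect {A D : Type*} [Mul A] [Star A] [One A] [Ring D] [Star D]
    (θ : A → D) (x : A) : D :=
  θ (star x * x) - 2 * (star (θ x) * θ x) + star (θ x) * (θ 1 * θ x)

theorem norm_sq_dilation (h : ∀ a ξ η, ⟪V ξ, φ a (V η)⟫_ℂ = ⟪ξ, θ a η⟫_ℂ) (ξ : L) :
    (‖V ξ‖ : ℂ) ^ 2 = ⟪ξ, θ 1 ξ⟫_ℂ := by
  rw [← h, map_one, one_apply_eq_self, inner_self_eq_norm_sq_to_K]
  rfl

theorem norm_dilation_le (h : ∀ a ξ η, ⟪V ξ, φ a (V η)⟫_ℂ = ⟪ξ, θ a η⟫_ℂ) (ξ : L) :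
    ‖V ξ‖ ^ 2 ≤ ‖θ 1‖ * ‖ξ‖ ^ 2 := by
  have h1 := congrArg norm (norm_sq_dilation h ξ)
  rw [norm_pow, Complex.norm_real, norm_norm] at h1
  rw [h1]
  refine (norm_inner_le_norm _ _).trans ?_
  nlinarith [(θ 1).le_opNorm ξ, norm_nonneg ξ]

/-- Since `V* V = θ 1` is within `1/2` of the identity, `‖ξ‖² - ‖V ξ‖²` is at most `‖ξ‖² / 2`. -/
theorem norm_le_norm_dilation (h : ∀ a ξ η, ⟪V ξ, φ a (V η)⟫_ℂ = ⟪ξ, θ a η⟫_ℂ)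
    (h1 : ‖θ 1 - 1‖ ≤ 1 / 2) (ξ : L) : ‖ξ‖ ^ 2 ≤ 2 * ‖V ξ‖ ^ 2 := by
  have e : ((‖ξ‖ ^ 2 - ‖V ξ‖ ^ 2 : ℝ) : ℂ) = - ⟪ξ, (θ 1 - 1) ξ⟫_ℂ := by
    rw [_root_.sub_apply, inner_sub_right, ← norm_sq_dilation h,
      one_apply_eq_self, inner_self_eq_norm_sq_to_K]
    push_cast
    simp
  have h2 := congrArg norm e
  rw [Complex.norm_real, norm_neg] at h2
  have h3 : ‖ξ‖ ^ 2 - ‖V ξ‖ ^ 2 ≤ ‖ξ‖ * (1 / 2 * ‖ξ‖) :=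
    (le_abs_self _).trans (h2.le.trans ((norm_inner_le_norm _ _).trans
      (mul_le_mul_of_nonneg_left (((θ 1 - 1).le_opNorm ξ).trans
        (mul_le_mul_of_nonneg_right h1 (norm_nonneg _))) (norm_nonneg _))))
  nlinarith

/-- Here `θ x = V* φ(x) V` sees only the compression of `φ x` to the range of `V`, and `‖V‖² ≤ ‖θ
1‖`. -/
theorem norm_le_norm_compression_dilation {L H : Type u} [NormedAddCommGroup L]
    [InnerProductSpace ℂ L]
    [NormedAddCommGroup H] [InnerProductSpace ℂ H] [CompleteSpace H]
    {θ : A → (L →L[ℂ] L)} {φ : A →⋆ₐ[ℂ] (H →L[ℂ] H)} {V : L →ₗ[ℂ] H}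
    (h : ∀ a ξ η, ⟪V ξ, φ a (V η)⟫_ℂ = ⟪ξ, θ a η⟫_ℂ) [V.range.HasOrthogonalProjection] (x : A) :
    ‖θ x‖ ≤ ‖θ 1‖ * ‖compression V.range (φ x)‖ := by
  refine ContinuousLinearMap.opNorm_le_bound _ (by positivity) fun ξ => ?_
  obtain ⟨η, hη⟩ : ∃ η, η = θ x ξ := ⟨_, rfl⟩
  let Vξ : V.range := ⟨V ξ, LinearMap.mem_range_self V _⟩
  let Vη : V.range := ⟨V η, LinearMap.mem_range_self V _⟩
  have e : ⟪η, η⟫_ℂ = ⟪Vη, compression V.range (φ x) Vξ⟫_ℂ := by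
    nth_rewrite 2 [hη]
    rw [← h]
    exact (Submodule.inner_orthogonalProjectionOnto_eq_of_mem_left Vη (φ x (V ξ))).symm
  have h1 : ‖η‖ ^ 2 ≤ ‖V η‖ * (‖compression V.range (φ x)‖ * ‖V ξ‖) := by
    have h2 := congrArg norm e
    rw [inner_self_eq_norm_sq_to_K, norm_pow] at h2
    simp only [Complex.coe_algebraMap, Complex.norm_real, norm_norm] at h2
    rw [h2]
    exact (norm_inner_le_norm _ _).trans
      (mul_le_mul_of_nonneg_left ((compression V.range (φ x)).le_opNorm Vξ) (norm_nonneg _))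
  have hs : ∀ ζ, ‖V ζ‖ ≤ √‖θ 1‖ * ‖ζ‖ := fun ζ => by
    refine (abs_le_of_sq_le_sq' ?_ (by positivity)).2
    rw [mul_pow, Real.sq_sqrt (norm_nonneg _)]
    exact norm_dilation_le h ζ
  have h3 : ‖η‖ ^ 2 ≤ ‖η‖ * (‖θ 1‖ * ‖compression V.range (φ x)‖ * ‖ξ‖) := by
    calc _ ≤ _ := h1
      _ ≤ (√‖θ 1‖ * ‖η‖) * (‖compression V.range (φ x)‖ * (√‖θ 1‖ * ‖ξ‖)) := by
        gcongr <;> exact hs _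
      _ = (√‖θ 1‖ * √‖θ 1‖) * (‖η‖ * ‖compression V.range (φ x)‖ * ‖ξ‖) := by ring
      _ = _ := by
        rw [Real.mul_self_sqrt (norm_nonneg _)]
        ring
  rw [← hη]
  rcases (norm_nonneg η).eq_or_lt with h0 | h0
  · rw [← h0]
    positivity
  · rw [pow_two] at h3
    exact le_of_mul_le_mul_left h3 h0

variable [CompleteSpace L]

/-- In the expanded square the first term is `θ (star x * x)`, the two cross terms give `-2 (θ x)*
(θ x)`, and `V* V = θ 1` gives the last: their sum is `multDefect θ x`. -/
theorem norm_sub_sq_dilation_le (h : ∀ a ξ η, ⟪V ξ, φ a (V η)⟫_ℂ = ⟪ξ, θ a η⟫_ℂ) (x : A) (ξ : L) :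
    ‖φ x (V ξ) - V (θ x ξ)‖ ^ 2 ≤ ‖multDefect θ x‖ * ‖ξ‖ ^ 2 := by
  have e1 : ⟪φ x (V ξ), φ x (V ξ)⟫_ℂ = ⟪ξ, θ (star x * x) ξ⟫_ℂ := by
    rw [← h, map_mul, map_star, mul_apply_eq_comp,
      ContinuousLinearMap.star_eq_adjoint, ContinuousLinearMap.adjoint_inner_right]
  have e2 : ⟪V (θ x ξ), φ x (V ξ)⟫_ℂ = ⟪ξ, (star (θ x) * θ x) ξ⟫_ℂ := by
    rw [h, mul_apply_eq_comp, ContinuousLinearMap.star_eq_adjoint,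
      ContinuousLinearMap.adjoint_inner_right]
  have e3 : ⟪φ x (V ξ), V (θ x ξ)⟫_ℂ = ⟪ξ, (star (θ x) * θ x) ξ⟫_ℂ := by
    rw [← inner_conj_symm, h, inner_conj_symm, mul_apply_eq_comp,
      ContinuousLinearMap.star_eq_adjoint, ContinuousLinearMap.adjoint_inner_right]
  have e4 : ⟪V (θ x ξ), V (θ x ξ)⟫_ℂ = ⟪ξ, (star (θ x) * (θ 1 * θ x)) ξ⟫_ℂ := by
    have := h 1 (θ x ξ) (θ x ξ)
    rw [map_one, one_apply_eq_self] at this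
    rw [this, mul_apply_eq_comp, mul_apply_eq_comp,
      ContinuousLinearMap.star_eq_adjoint, ContinuousLinearMap.adjoint_inner_right]
  have e : ((‖φ x (V ξ) - V (θ x ξ)‖ : ℝ) : ℂ) ^ 2 = ⟪ξ, multDefect θ x ξ⟫_ℂ := by
    have := inner_self_eq_norm_sq_to_K (𝕜 := ℂ) (φ x (V ξ) - V (θ x ξ))
    refine this.symm.trans ?_
    rw [inner_sub_left, inner_sub_right, inner_sub_right, e1, e2, e3, e4, multDefect, two_mul]
    simp only [_root_.add_apply, _root_.sub_apply, inner_add_right,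
      inner_sub_right]
    ring
  have h1 := congrArg norm e
  rw [norm_pow, Complex.norm_real, norm_norm] at h1
  rw [h1]
  refine (norm_inner_le_norm _ _).trans ?_
  nlinarith [(multDefect θ x).le_opNorm ξ, norm_nonneg ξ]

/-- The projection of `φ x (V ξ)` is its nearest point in the range, and `V (θ x ξ)` is a
competitor. The factor `2` pays for replacing `‖ξ‖²` by `2 ‖V ξ‖²`. -/
theorem norm_sub_starProjection_range_dilation_le
    (h : ∀ a ξ η, ⟪V ξ, φ a (V η)⟫_ℂ = ⟪ξ, θ a η⟫_ℂ)
    (h1 : ‖θ 1 - 1‖ ≤ 1 / 2) [V.range.HasOrthogonalProjection] {x : A} {r : ℝ} (hr : 0 ≤ r)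
    (hx : 2 * ‖multDefect θ x‖ ≤ r ^ 2) (k : H) (hk : k ∈ V.range) :
    ‖φ x k - V.range.starProjection (φ x k)‖ ≤ r * ‖k‖ := by
  obtain ⟨ξ, rfl⟩ := hk
  have h2 : ‖φ x (V ξ) - V.range.starProjection (φ x (V ξ))‖ ≤ ‖φ x (V ξ) - V (θ x ξ)‖ := by
    rw [Submodule.starProjection_minimal]
    exact ciInf_le ⟨0, by rintro _ ⟨y, rfl⟩; exact norm_nonneg _⟩
      (⟨V (θ x ξ), LinearMap.mem_range_self V _⟩ : V.range)
  refine h2.trans (abs_le_of_sq_le_sq' ?_ (by positivity)).2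
  refine (norm_sub_sq_dilation_le h x ξ).trans ?_
  rw [mul_pow]
  calc _ ≤ ‖multDefect θ x‖ * (2 * ‖V ξ‖ ^ 2) :=
        mul_le_mul_of_nonneg_left (norm_le_norm_dilation h h1 ξ) (norm_nonneg _)
    _ = (2 * ‖multDefect θ x‖) * ‖V ξ‖ ^ 2 := by ring
    _ ≤ _ := mul_le_mul_of_nonneg_right hx (by positivity)

end Dilation

theorem norm_compression_le {H : Type u} [NormedAddCommGroup H] [InnerProductSpace ℂ H]
    (K : Submodule ℂ H) [K.HasOrthogonalProjection] (T : H →L[ℂ] H) :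
    ‖compression K T‖ ≤ ‖T‖ := by
  refine ContinuousLinearMap.opNorm_le_bound _ (norm_nonneg _) fun k => ?_
  have h : ‖K.orthogonalProjectionOnto (T k)‖ ≤ ‖T k‖ :=
    Submodule.norm_orthogonalProjectionOnto_apply_le _ _
  exact h.trans (T.le_opNorm k)

theorem exists_compression_of_approx {A : Type u} [CStarAlgebra A] [PartialOrder A]
    [StarOrderedRing A] {L : Type u} [NormedAddCommGroup L] [InnerProductSpace ℂ L]
    [CompleteSpace L] [FiniteDimensional ℂ L]
    (θ : A →ₗ[ℂ] (L →L[ℂ] L)) (hθ : HasPositiveForms θ) (F : Finset A) {ε μ : ℝ} (hε : 0 < ε)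
    (hμ : μ ≤ 1 / 2) (h1 : ‖θ 1 - 1‖ ≤ μ)
    (hF : ∀ x ∈ F, ‖x‖ - ε / 2 ≤ ‖θ x‖ ∧ μ * ‖x‖ ≤ ε / 2 ∧
      2 * ‖multDefect θ x‖ ≤ (ε / 2) ^ 2 ∧ 2 * ‖multDefect θ (star x)‖ ≤ (ε / 2) ^ 2) :
    ∃ (H : Type u) (_ : NormedAddCommGroup H) (_ : InnerProductSpace ℂ H) (_ : CompleteSpace H)
      (φ : A →⋆ₐ[ℂ] (H →L[ℂ] H)) (K : Submodule ℂ H) (_ : FiniteDimensional ℂ K),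
      ∀ x ∈ F, ‖x‖ - ε ≤ ‖compression K (φ x)‖ ∧
        ‖φ x * K.starProjection - K.starProjection * φ x‖ ≤ ε := by
  obtain ⟨H, i1, i2, i3, φ, V, h⟩ := exists_dilation θ hθ
  refine ⟨H, i1, i2, i3, φ, V.range, inferInstance, fun x hx => ?_⟩
  obtain ⟨hx1, hx2, hx3, hx4⟩ := hF x hx
  constructor
  · have hc : ‖compression V.range (φ x)‖ ≤ ‖x‖ := by
      exact (norm_compression_le _ _).trans (NonUnitalStarAlgHom.norm_apply_le φ x)
    have h2 : ‖θ 1‖ ≤ 1 + μ := by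
      have h3 : ‖(1 : L →L[ℂ] L)‖ ≤ 1 := ContinuousLinearMap.norm_id_le
      have h4 := norm_add_le (1 : L →L[ℂ] L) (θ 1 - 1)
      rw [add_sub_cancel] at h4
      linarith
    have h5 := norm_le_norm_compression_dilation h x
    have h6 : 0 ≤ μ := (norm_nonneg _).trans h1
    -- `‖x‖ - ε/2 ≤ (1 + μ) ‖compr‖ ≤ ‖compr‖ + μ ‖x‖`, and `μ ‖x‖ ≤ ε/2`.
    nlinarith [norm_nonneg (compression V.range (φ x))]
  · have h7 := norm_commutator_starProjection_le V.range (φ x) (r := ε / 2) (by positivity)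
      (norm_sub_starProjection_range_dilation_le h (h1.trans hμ) (by positivity) hx3)
      (by
        rw [← map_star]
        exact norm_sub_starProjection_range_dilation_le h (h1.trans hμ) (by positivity) hx4)
    linarith

/-! ### Completely positive maps with movable coefficients. -/

section Model

/-- The map `a ↦ ∑ g k l a • (y m k)* (y m l)`, which is completely positive when the matrix of
functionals `g` is. -/
noncomputable def schurMap {A D : Type*} [AddCommGroup A] [Module ℂ A] [Ring D] [StarRing D]
    [Algebra ℂ D] {N : ℕ} (g : Fin N → Fin N → A →ₗ[ℂ] ℂ) (y : Fin N → Fin N → D) : A →ₗ[ℂ] D :=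
  ∑ m, ∑ k, ∑ l, (g k l).smulRight (star (y m k) * y m l)

theorem schurMap_apply {A D : Type*} [AddCommGroup A] [Module ℂ A] [Ring D] [StarRing D]
    [Algebra ℂ D] {N : ℕ} (g : Fin N → Fin N → A →ₗ[ℂ] ℂ) (y : Fin N → Fin N → D) (a : A) :
    schurMap g y a = ∑ m, ∑ k, ∑ l, g k l a • (star (y m k) * y m l) := by
  simp [schurMap]

theorem map_schurMap {A D E : Type*} [AddCommGroup A] [Module ℂ A] [Ring D] [StarRing D]
    [Algebra ℂ D] [Ring E] [StarRing E] [Algebra ℂ E] (f : D →⋆ₐ[ℂ] E)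
    {N : ℕ} (g : Fin N → Fin N → A →ₗ[ℂ] ℂ) (y : Fin N → Fin N → D) (a : A) :
    f (schurMap g y a) = schurMap g (fun m k => f (y m k)) a := by
  simp [schurMap_apply, map_sum, map_star f]

theorem map_multDefect {A D E : Type*} [Mul A] [Star A] [One A] [Ring D] [StarRing D]
    [Algebra ℂ D] [Ring E] [StarRing E] [Algebra ℂ E] (f : D →⋆ₐ[ℂ] E) (θ : A → D) (x : A) :
    f (multDefect θ x) = multDefect (fun a => f (θ a)) x := by
  simp [multDefect, map_star f, map_ofNat f 2]

/-- An entrywise product of two Gram matrices: the sum equals `∑ r, ‖∑ s, w r s • ζ s‖²`. -/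
theorem sum_gram_nonneg {E : Type*} [NormedAddCommGroup E] [InnerProductSpace ℂ E]
    {S R : Type*} [Fintype S] [Fintype R] (w : R → S → ℂ) (ζ : S → E) :
    0 ≤ ∑ s, ∑ t, (∑ r, star (w r s) * w r t) * ⟪ζ s, ζ t⟫_ℂ := by
  have h : ∑ s, ∑ t, (∑ r, star (w r s) * w r t) * ⟪ζ s, ζ t⟫_ℂ =
      ∑ r, ⟪∑ s, w r s • ζ s, ∑ t, w r t • ζ t⟫_ℂ := by
    simp only [sum_inner]
    simp only [inner_sum, inner_smul_left, inner_smul_right, Finset.sum_mul]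
    calc _ = ∑ s, ∑ r, ∑ t, star (w r s) * w r t * ⟪ζ s, ζ t⟫_ℂ :=
          Finset.sum_congr rfl fun s _ => Finset.sum_comm
      _ = ∑ r, ∑ s, ∑ t, star (w r s) * w r t * ⟪ζ s, ζ t⟫_ℂ := Finset.sum_comm
      _ = _ := by
          refine Finset.sum_congr rfl fun r _ => Finset.sum_congr rfl fun s _ =>
            Finset.sum_congr rfl fun t _ => ?_
          rw [Complex.star_def]
          ring
  rw [h]
  exact Finset.sum_nonneg fun r _ => CStarModule.inner_self_nonneg

theorem exists_eq_star_mul_self_of_nonneg {D : Type*} [NonUnitalCStarAlgebra D] [PartialOrder D]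
    [StarOrderedRing D] {x : D} (hx : 0 ≤ x) : ∃ y, x = star y * y :=
  CStarAlgebra.nonneg_iff_eq_star_mul_self.1 hx

variable {A : Type u} [CStarAlgebra A] [PartialOrder A] [StarOrderedRing A]

/-- Complete positivity of a map `g` from `A` to scalar matrices. -/
def IsPositiveKernel {N : ℕ} (g : Fin N → Fin N → A →ₗ[ℂ] ℂ) : Prop :=
  ∀ (n : ℕ) (M : CStarMatrix (Fin n) (Fin n) A), 0 ≤ M →
    ∀ (E : Type u) (_ : NormedAddCommGroup E) (_ : InnerProductSpace ℂ E)
      (ζ : Fin n × Fin N → E), 0 ≤ ∑ s, ∑ t, g s.2 t.2 (M s.1 t.1) * ⟪ζ s, ζ t⟫_ℂ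

/-- For each `m` the form is the kernel tested on the vectors `y m k (ξ i)`. Positivity comes from
`g` alone, so the `y m k` may be any operators; this makes arbitrary lifts admissible. -/
theorem IsPositiveKernel.hasPositiveForms {N : ℕ} {g : Fin N → Fin N → A →ₗ[ℂ] ℂ}
    (hg : IsPositiveKernel g) {L : Type u} [NormedAddCommGroup L] [InnerProductSpace ℂ L]
    [CompleteSpace L] (y : Fin N → Fin N → (L →L[ℂ] L)) : HasPositiveForms (schurMap g y) := by
  intro n M hM ξ
  have h : ∑ i, ∑ j, ⟪ξ i, schurMap g y (M i j) (ξ j)⟫_ℂ =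
      ∑ m, ∑ s : Fin n × Fin N, ∑ t : Fin n × Fin N,
        g s.2 t.2 (M s.1 t.1) * ⟪y m s.2 (ξ s.1), y m t.2 (ξ t.1)⟫_ℂ := by
    have h1 : ∀ i j, ⟪ξ i, schurMap g y (M i j) (ξ j)⟫_ℂ =
        ∑ m, ∑ k, ∑ l, g k l (M i j) * ⟪y m k (ξ i), y m l (ξ j)⟫_ℂ := by
      intro i j
      simp only [schurMap_apply, _root_.sum_apply, inner_sum, _root_.smul_apply,
        inner_smul_right, mul_apply_eq_comp, ContinuousLinearMap.star_eq_adjoint,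
        ContinuousLinearMap.adjoint_inner_right]
    simp only [h1, Fintype.sum_prod_type]
    calc _ = ∑ i, ∑ m, ∑ j, ∑ k, ∑ l, g k l (M i j) * ⟪y m k (ξ i), y m l (ξ j)⟫_ℂ :=
          Finset.sum_congr rfl fun i _ => Finset.sum_comm
      _ = ∑ m, ∑ i, ∑ j, ∑ k, ∑ l, g k l (M i j) * ⟪y m k (ξ i), y m l (ξ j)⟫_ℂ :=
          Finset.sum_comm
      _ = _ := Finset.sum_congr rfl fun m _ => Finset.sum_congr rfl fun i _ => Finset.sum_comm
  rw [h]
  exact Finset.sum_nonneg fun m _ => hg n M hM L _ _ fun s => y m s.2 (ξ s.1)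

/-- Writing the image of `M` under `ψ` as `star Z * Z` and applying Parseval in the basis `c`
exhibits the coefficients as a Gram matrix. -/
theorem isPositiveKernel_of_completelyPositive {C : Type u} [CStarAlgebra C] [PartialOrder C]
    [StarOrderedRing C] [FiniteDimensional ℂ C] (ψ : A →CP C) {N : ℕ} {c : Fin N → C}
    (hc : ∀ y, ∑ k, regularTrace C (star (c k) * y) • c k = y)
    (g : Fin N → Fin N → A →ₗ[ℂ] ℂ)
    (hg : ∀ k l a, g k l a = regularTrace C (star (c k) * (ψ a * c l))) :
    IsPositiveKernel g := by
  intro n M hM E _ _ ζ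
  obtain ⟨Z, hZ⟩ := exists_eq_star_mul_self_of_nonneg (ψ.map_cstarMatrix_nonneg' n M hM)
  have h1 : ∀ i j, ψ (M i j) = ∑ p, star (Z p i) * Z p j := by
    intro i j
    have := congrFun (congrFun hZ i) j
    rw [CStarMatrix.mul_apply] at this
    exact this
  have h2 : ∀ s t : Fin n × Fin N, g s.2 t.2 (M s.1 t.1) = ∑ r : Fin n × Fin N,
      star (regularTrace C (star (c r.2) * (Z r.1 s.1 * c s.2))) *
        regularTrace C (star (c r.2) * (Z r.1 t.1 * c t.2)) := by
    intro s t
    rw [hg, h1, Fintype.sum_prod_type, Finset.sum_mul, Finset.mul_sum, map_sum]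
    refine Finset.sum_congr rfl fun p _ => ?_
    refine Eq.trans ?_ (regularTrace_star_mul_eq_sum hc (Z p s.1 * c s.2) (Z p t.1 * c t.2))
    simp only [star_mul, mul_assoc]
  simp only [h2]
  exact sum_gram_nonneg _ ζ

/-- The matrix `(c k * star (c l))` is a column times its adjoint, hence positive; its image under
`ρ` is therefore `star y * y`. -/
theorem exists_eq_sum_star_mul {C : Type u} [CStarAlgebra C] [PartialOrder C]
    [StarOrderedRing C] (ρ : C →CP A) {N : ℕ} (c : Fin N → C) :
    ∃ y : Fin N → Fin N → A, ∀ k l, ρ (c k * star (c l)) = ∑ m, star (y m k) * y m l := by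
  -- The column `c`, padded with zeros to a square matrix.
  let Z : CStarMatrix (Fin N) (Fin N) C :=
    CStarMatrix.ofMatrix fun k j => if j.val = 0 then c k else 0
  have hZa : ∀ k j, Z k j = if j.val = 0 then c k else 0 := fun k j => rfl
  have hZ : ∀ k l, (Z * star Z) k l = c k * star (c l) := by
    intro k l
    rw [CStarMatrix.mul_apply, Finset.sum_eq_single ⟨0, k.pos⟩]
    · rw [CStarMatrix.star_apply, hZa, hZa, if_pos rfl, if_pos rfl]
    · intro j _ hj
      rw [hZa, if_neg fun h => hj (Fin.ext h), zero_mul]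
    · simp
  obtain ⟨y, hy⟩ := exists_eq_star_mul_self_of_nonneg
    (ρ.map_cstarMatrix_nonneg' N (Z * star Z) (mul_star_self_nonneg Z))
  refine ⟨fun m k => y m k, fun k l => ?_⟩
  have := congrFun (congrFun hy k) l
  rw [CStarMatrix.mul_apply] at this
  rw [← hZ]
  exact this

/-- In a nuclear C*-algebra the identity is approximated by maps of the form `schurMap`. -/
theorem IsNuclear.exists_schurMap (hA : IsNuclear A) (F : Finset A) {ε : ℝ} (hε : 0 < ε) :
    ∃ (N : ℕ) (g : Fin N → Fin N → A →ₗ[ℂ] ℂ) (y : Fin N → Fin N → A), IsPositiveKernel g ∧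
      ∀ x ∈ F, ‖schurMap g y x - x‖ ≤ ε := by
  obtain ⟨φ, ⟨C, _, _, _, _, ψ, ρ, -, -, hφ⟩, hF⟩ := hA.2 F ε hε
  obtain ⟨N, c, hc, hc1⟩ := exists_regularTrace_frame C
  obtain ⟨y, hy⟩ := exists_eq_sum_star_mul ρ c
  let g : Fin N → Fin N → A →ₗ[ℂ] ℂ := fun k l =>
    regularTrace C ∘ₗ LinearMap.mulLeft ℂ (star (c k)) ∘ₗ LinearMap.mulRight ℂ (c l) ∘ₗ
      ψ.toLinearMap
  have hg : ∀ k l a, g k l a = regularTrace C (star (c k) * (ψ a * c l)) := fun k l a => rfl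
  refine ⟨N, g, y, isPositiveKernel_of_completelyPositive ψ hc g hg, fun x hx => ?_⟩
  have h1 : schurMap g y x = φ x := by
    rw [hφ, ← regularTrace_frame_expansion hc hc1 (ψ x), schurMap_apply]
    simp only [map_sum, map_smul, hy, hg]
    rw [Finset.sum_comm]
    refine Finset.sum_congr rfl fun k _ => ?_
    rw [Finset.sum_comm]
    simp only [Finset.smul_sum]
  rw [h1]
  exact hF x hx

end Model

/-! ### Moving the approximation into one coordinate of the hull. -/

section Hull

variable {ι : Type v} (U : Ultrafilter ι) (B : ι → Type u) [∀ i, CStarAlgebra (B i)]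

/-- The quotient map to the infinitesimal hull. -/
noncomputable def FinPart.mkHom : FinPart U B →⋆ₐ[ℂ] Hull U B where
  toFun := SeparationQuotient.mk
  map_one' := rfl
  map_zero' := rfl
  map_add' _ _ := rfl
  map_mul' _ _ := rfl
  commutes' _ := rfl
  map_star' _ := rfl

/-- Evaluation of representing families at an index. -/
noncomputable def FinPart.coordHom (i : ι) : FinPart U B →⋆ₐ[ℂ] B i where
  toFun x := x.coord i
  map_one' := rfl
  map_zero' := rfl
  map_add' _ _ := rfl
  map_mul' _ _ := rfl
  commutes' _ := rfl
  map_star' _ := rfl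

variable {U B}

theorem FinPart.tendsto_norm_mkHom (x : FinPart U B) :
    Tendsto (fun i => ‖FinPart.coordHom U B i x‖) (U : Filter ι) (𝓝 ‖FinPart.mkHom U B x‖) := by
  have h : ‖FinPart.mkHom U B x‖ = ‖x‖ := SeparationQuotient.norm_mk x
  rw [h]
  exact x.tendsto_norm

end Hull

/-- The defect of multiplicativity at `x` is less than `κ` for all maps that move `1`, `x` and
`star x * x` by less than `η`. -/
def ControlsMultDefect {A : Type*} [CStarAlgebra A] (x : A) (κ η : ℝ) : Prop :=
  ∀ θ : A → A, ‖θ (star x * x) - star x * x‖ < η → ‖θ x - x‖ < η → ‖θ 1 - 1‖ < η →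
    ‖multDefect θ x‖ < κ

/-- The defect is a continuous expression in `(θ (star x * x), θ x, θ 1)` and vanishes at `(star x *
x, x, 1)`. -/
theorem eventually_controlsMultDefect {A : Type*} [CStarAlgebra A] (x : A) {κ : ℝ} (hκ : 0 < κ) :
    ∀ᶠ η in 𝓝[>] (0 : ℝ), ControlsMultDefect x κ η := by
  have hc : Continuous fun p : A × A × A =>
      ‖p.1 - 2 * (star p.2.1 * p.2.1) + star p.2.1 * (p.2.2 * p.2.1)‖ := by fun_prop
  have h0 : ‖star x * x - 2 * (star x * x) + star x * (1 * x)‖ < κ := by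
    have : star x * x - 2 * (star x * x) + star x * (1 * x) = 0 := by
      rw [one_mul, two_mul]
      abel
    rwa [this, norm_zero]
  obtain ⟨r, hr, h⟩ := Metric.eventually_nhds_iff.1
    (hc.tendsto (star x * x, x, 1) |>.eventually (gt_mem_nhds h0))
  filter_upwards [Ioo_mem_nhdsGT hr] with η hη θ h1 h2 h3
  refine h (y := (θ (star x * x), θ x, θ 1)) ?_
  simp only [dist_eq_norm]
  exact max_lt (h1.trans hη.2) (max_lt (h2.trans hη.2) (h3.trans hη.2))

theorem hasAlmostCommutingCompressions_of_isNuclear {ι : Type v} (U : Ultrafilter ι)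
    {A : Type u} [CStarAlgebra A] [PartialOrder A] [StarOrderedRing A]
    (hA : IsNuclear A) (hU : IsSubhyperfinite U A) : HasAlmostCommutingCompressions A := by
  classical
  obtain ⟨B, _, _, f, hf⟩ := hU
  intro ε hε F
  have hκ : 0 < (ε / 2) ^ 2 / 2 := by positivity
  obtain ⟨η, hη, hη2, hηF⟩ : ∃ η : ℝ, 0 < η ∧ η < 1 / 2 ∧ ∀ x ∈ F, η < ε / 2 ∧ η * ‖x‖ < ε / 2 ∧
      ControlsMultDefect x ((ε / 2) ^ 2 / 2) η ∧
      ControlsMultDefect (star x) ((ε / 2) ^ 2 / 2) η := by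
    have h : ∀ᶠ η in 𝓝[>] (0 : ℝ), η < 1 / 2 ∧ ∀ x ∈ F, η < ε / 2 ∧ η * ‖x‖ < ε / 2 ∧
        ControlsMultDefect x ((ε / 2) ^ 2 / 2) η ∧
        ControlsMultDefect (star x) ((ε / 2) ^ 2 / 2) η := by
      refine Eventually.and ?_ ?_
      · exact eventually_nhdsWithin_of_eventually_nhds (gt_mem_nhds (by norm_num))
      refine (eventually_all_finset F).2 fun x _ => Eventually.and ?_ (Eventually.and ?_ ?_)
      · exact eventually_nhdsWithin_of_eventually_nhds (gt_mem_nhds (by positivity))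
      · refine eventually_nhdsWithin_of_eventually_nhds ?_
        have hc : Continuous fun η : ℝ => η * ‖x‖ := by fun_prop
        refine hc.tendsto 0 |>.eventually (gt_mem_nhds ?_)
        rw [zero_mul]
        positivity
      · exact (eventually_controlsMultDefect x hκ).and
          (eventually_controlsMultDefect (star x) hκ)
    have h0 : ∀ᶠ η in 𝓝[>] (0 : ℝ), 0 < η := self_mem_nhdsWithin
    exact (h0.and h).exists
  -- All elements at which closeness to the identity is needed to control the defects at `x` and
  -- `star x`.
  let F' : Finset A := insert 1 (F ∪ F.image star ∪ F.image (fun x => star x * x) ∪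
    F.image fun x => star (star x) * star x)
  obtain ⟨N, g, y, hg, hy⟩ := hA.exists_schurMap F' (half_pos hη)
  have hy' : ∀ x ∈ F', ‖schurMap g y x - x‖ < η := fun x hx =>
    (hy x hx).trans_lt (half_lt_self hη)
  have hone : ‖schurMap g y 1 - 1‖ < η := hy' 1 (Finset.mem_insert_self _ _)
  have hfn : ∀ a, ‖f a‖ = ‖a‖ := fun a => NonUnitalStarAlgHom.norm_map f hf a
  -- The lifts need satisfy no relations: complete positivity is carried by `g`.
  choose w hw using fun m k => SeparationQuotient.surjective_mk (f (y m k))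
  have hθ : ∀ a, FinPart.mkHom U B (schurMap g w a) = f (schurMap g y a) := by
    intro a
    rw [map_schurMap, map_schurMap]
    exact congrArg (fun z => schurMap g z a) (funext fun m => funext fun k => hw m k)
  have hdef : ∀ x, FinPart.mkHom U B (multDefect (schurMap g w) x) =
      f (multDefect (schurMap g y) x) := by
    intro x
    rw [map_multDefect, map_multDefect]
    simp only [hθ]
  have hev : ∀ᶠ i in (U : Filter ι), ‖FinPart.coordHom U B i (schurMap g w 1 - 1)‖ < η ∧
      ∀ x ∈ F, ‖x‖ - ε / 2 < ‖FinPart.coordHom U B i (schurMap g w x)‖ ∧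
        ‖FinPart.coordHom U B i (multDefect (schurMap g w) x)‖ < (ε / 2) ^ 2 / 2 ∧
        ‖FinPart.coordHom U B i (multDefect (schurMap g w) (star x))‖ < (ε / 2) ^ 2 / 2 := by
    refine Eventually.and ?_ ((eventually_all_finset F).2 fun x hx =>
      Eventually.and ?_ (Eventually.and ?_ ?_))
    · refine (FinPart.tendsto_norm_mkHom _).eventually (gt_mem_nhds ?_)
      rwa [map_sub, hθ, map_one (FinPart.mkHom U B), ← map_one f, ← map_sub, hfn]
    · refine (FinPart.tendsto_norm_mkHom _).eventually (lt_mem_nhds ?_)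
      rw [hθ, hfn]
      have h1 := hy' x (by simp [F', hx])
      have h2 := norm_sub_norm_le x (schurMap g y x)
      rw [norm_sub_rev] at h2
      linarith [(hηF x hx).1]
    · refine (FinPart.tendsto_norm_mkHom _).eventually (gt_mem_nhds ?_)
      rw [hdef, hfn]
      refine (hηF x hx).2.2.1 _ (hy' _ ?_) (hy' _ ?_) hone
      · simp only [F', Finset.mem_insert, Finset.mem_union, Finset.mem_image]
        exact Or.inr (Or.inl (Or.inr ⟨x, hx, rfl⟩))
      · simp [F', hx]
    · refine (FinPart.tendsto_norm_mkHom _).eventually (gt_mem_nhds ?_)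
      rw [hdef, hfn]
      refine (hηF x hx).2.2.2 _ (hy' _ ?_) (hy' _ ?_) hone
      · simp only [F', Finset.mem_insert, Finset.mem_union, Finset.mem_image]
        exact Or.inr (Or.inr ⟨x, hx, rfl⟩)
      · simp only [F', Finset.mem_insert, Finset.mem_union, Finset.mem_image]
        exact Or.inr (Or.inl (Or.inl (Or.inr ⟨x, hx, rfl⟩)))
  -- Only finitely many norm inequalities are required, so a single index satisfies them all.
  obtain ⟨i, hi1, hiF⟩ := hev.exists
  obtain ⟨L, _, _, _, _, π, hπ⟩ := exists_faithful_finiteDimensional_rep (B i)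
  let q : FinPart U B →⋆ₐ[ℂ] (L →L[ℂ] L) := π.comp (FinPart.coordHom U B i)
  have hq : ∀ z, ‖q z‖ = ‖FinPart.coordHom U B i z‖ := fun z => hπ _
  have hqθ : ∀ a, schurMap g (fun m k => q (w m k)) a = q (schurMap g w a) := fun a =>
    (map_schurMap q g w a).symm
  have hqd : ∀ x, multDefect (schurMap g fun m k => q (w m k)) x =
      q (multDefect (schurMap g w) x) := by
    intro x
    rw [map_multDefect]
    simp only [← hqθ]
  refine exists_compression_of_approx _ (hg.hasPositiveForms fun m k => q (w m k)) F hε hη2.le ?_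
    fun x hx => ⟨?_, (hηF x hx).2.1.le, ?_, ?_⟩
  · rw [hqθ, ← map_one q, ← map_sub, hq]
    exact hi1.le
  · rw [hqθ, hq]
    exact (hiF x hx).1.le
  · rw [hqd, hq]
    linarith [(hiF x hx).2.1]
  · rw [hqd, hq]
    linarith [(hiF x hx).2.2]

/-! ### From almost commuting compressions to an embedding in the hull. -/

theorem exists_tendsto_nat_of_not_countably_complete {ι : Type v} (U : Ultrafilter ι)
    (hU : ∃ S : ℕ → Set ι, (∀ n, S n ∈ U) ∧ (⋂ n, S n) ∉ U) :
    ∃ ν : ι → ℕ, Tendsto ν (U : Filter ι) atTop := by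
  classical
  obtain ⟨S, hS, hI⟩ := hU
  -- The first stage at which `i` leaves the sets `S k`, which is at least `m` if `i` lies in the
  -- first `m` of them. The default `sInf ∅ = 0` occurs only on `⋂ n, S n`, which is not in `U`.
  refine ⟨fun i => sInf {k | i ∉ S k}, tendsto_atTop.2 fun m => ?_⟩
  have h1 : ∀ᶠ i in (U : Filter ι), i ∉ ⋂ n, S n := Ultrafilter.compl_mem_iff_notMem.2 hI
  have h2 : ∀ᶠ i in (U : Filter ι), ∀ k ∈ Finset.range m, i ∈ S k :=
    (eventually_all_finset _).2 fun k _ => hS k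
  filter_upwards [h1, h2] with i hi1 hi2
  have hne : {k | i ∉ S k}.Nonempty := by
    simpa [Set.mem_iInter, Set.Nonempty] using hi1
  refine le_csInf hne fun k hk => ?_
  by_contra! hlt
  exact hk (hi2 k (Finset.mem_range.2 hlt))

section Compression

variable {H : Type u} [NormedAddCommGroup H] [InnerProductSpace ℂ H]
  (K : Submodule ℂ H) [K.HasOrthogonalProjection]

theorem compression_one : compression K 1 = 1 := by
  ext k
  change ((K.orthogonalProjectionOnto (k : H) : K) : H) = k
  rw [K.orthogonalProjectionOnto_mem_subspace_eq_self]

/-- On `K` the difference is `P S (T P - P T)`. Only the right factor has to almost commute with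
`P`, so `S` is arbitrary. -/
theorem norm_compression_mul_sub_le (S T : H →L[ℂ] H) :
    ‖compression K (S * T) - compression K S * compression K T‖ ≤
      ‖S‖ * ‖T * K.starProjection - K.starProjection * T‖ := by
  refine ContinuousLinearMap.opNorm_le_bound _ (by positivity) fun k => ?_
  have h1 : (compression K (S * T) - compression K S * compression K T) k =
      K.orthogonalProjectionOnto
        (S ((T * K.starProjection - K.starProjection * T) (k : H))) := by
    have hk : K.starProjection (k : H) = k := K.starProjection_eq_self_iff.2 k.2
    rw [_root_.sub_apply (T * K.starProjection), mul_apply_eq_comp, mul_apply_eq_comp, hk,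
      map_sub, map_sub]
    rfl
  rw [h1]
  refine (K.norm_orthogonalProjectionOnto_apply_le _).trans ((S.le_opNorm _).trans ?_)
  rw [mul_assoc]
  exact mul_le_mul_of_nonneg_left (ContinuousLinearMap.le_opNorm _ _) (norm_nonneg _)

theorem compression_star [CompleteSpace H] [CompleteSpace K] (T : H →L[ℂ] H) :
    compression K (star T) = star (compression K T) := by
  rw [ContinuousLinearMap.star_eq_adjoint (compression K T),
    ContinuousLinearMap.eq_adjoint_iff]
  intro x y
  have h1 : ⟪compression K (star T) x, y⟫_ℂ = ⟪star T (x : H), (y : H)⟫_ℂ :=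
    Submodule.inner_orthogonalProjectionOnto_eq_of_mem_right y _
  have h2 : ⟪x, compression K T y⟫_ℂ = ⟪(x : H), T (y : H)⟫_ℂ :=
    Submodule.inner_orthogonalProjectionOnto_eq_of_mem_left x _
  rw [h1, h2, ContinuousLinearMap.star_eq_adjoint, ContinuousLinearMap.adjoint_inner_left]

end Compression

/-- Approximately multiplicative and isometric maps to finite dimensional C*-algebras. -/
theorem HasAlmostCommutingCompressions.exists_approx {A : Type u} [CStarAlgebra A]
    (hA : HasAlmostCommutingCompressions A) {ε : ℝ} (hε : 0 < ε) (F : Finset A) :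
    ∃ (C : Type u) (_ : CStarAlgebra C) (_ : FiniteDimensional ℂ C) (κ : A →ₗ[ℂ] C),
      κ 1 = 1 ∧ (∀ x, κ (star x) = star (κ x)) ∧ (∀ x, ‖κ x‖ ≤ ‖x‖) ∧
      ∀ y ∈ F, ‖y‖ - ε ≤ ‖κ y‖ ∧ ∀ x, ‖κ (x * y) - κ x * κ y‖ ≤ ‖x‖ * ε := by
  obtain ⟨H, _, _, _, φ, K, _, h⟩ := hA ε hε F
  let κ : A →ₗ[ℂ] (K →L[ℂ] K) :=
    { toFun := fun x => compression K (φ x)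
      map_add' := fun x y => by
        ext k
        simp [compression]
      map_smul' := fun r x => by
        ext k
        simp [compression] }
  refine ⟨K →L[ℂ] K, inferInstance, inferInstance, κ, ?_, fun x => ?_, fun x => ?_,
    fun y hy => ⟨(h y hy).1, fun x => ?_⟩⟩
  · change compression K (φ 1) = 1
    rw [map_one, compression_one]
  · change compression K (φ (star x)) = _
    rw [map_star, compression_star]
    rfl
  · exact (norm_compression_le K _).trans (NonUnitalStarAlgHom.norm_apply_le φ x)
  · change ‖compression K (φ (x * y)) - compression K (φ x) * compression K (φ y)‖ ≤ _
    rw [map_mul]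
    exact (norm_compression_mul_sub_le K _ _).trans
      (mul_le_mul (NonUnitalStarAlgHom.norm_apply_le φ x) (h y hy).2 (norm_nonneg _)
        (norm_nonneg _))

theorem mk_eq_mk_of_eventually_le {ι : Type v} {U : Ultrafilter ι} {B : ι → Type u}
    [∀ i, CStarAlgebra (B i)] {a b : FinPart U B}
    (h : ∀ δ > 0, ∀ᶠ i in (U : Filter ι), ‖a.coord i - b.coord i‖ ≤ δ) :
    (SeparationQuotient.mk a : Hull U B) = SeparationQuotient.mk b := by
  rw [← sub_eq_zero, ← norm_le_zero_iff, ← SeparationQuotient.mk_sub, SeparationQuotient.norm_mk]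
  exact le_of_forall_pos_le_add fun δ hδ => by
    rw [zero_add]
    exact FinPart.norm_le_of_eventually (h δ hδ)

theorem isSubhyperfinite_of_hasAlmostCommutingCompressions {ι : Type v} (U : Ultrafilter ι)
    (hU : ∃ S : ℕ → Set ι, (∀ n, S n ∈ U) ∧ (⋂ n, S n) ∉ U)
    {A : Type u} [CStarAlgebra A] [TopologicalSpace.SeparableSpace A]
    (hA : HasAlmostCommutingCompressions A) : IsSubhyperfinite U A := by
  classical
  obtain ⟨ν, hν⟩ := exists_tendsto_nat_of_not_countably_complete U hU
  let d := TopologicalSpace.denseSeq A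
  have hpos : ∀ n : ℕ, (0 : ℝ) < 1 / (n + 1) := fun n => by positivity
  -- Stage `n` has error `1/(n+1)` on the first `n` terms of the dense sequence.
  choose C i1 i2 κ hone hstar hle hF using fun n : ℕ =>
    hA.exists_approx (hpos n) ((Finset.range n).image d)
  have hsmall : ∀ δ > 0, ∀ᶠ i in (U : Filter ι), (1 : ℝ) / (ν i + 1) ≤ δ := fun δ hδ =>
    (tendsto_one_div_add_atTop_nhds_zero_nat.comp hν).eventually (ge_mem_nhds hδ)
  have happrox : ∀ (y : A) (δ : ℝ), 0 < δ → ∃ z, ‖y - z‖ < δ ∧ ∀ᶠ i in (U : Filter ι),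
      z ∈ (Finset.range (ν i)).image d := by
    intro y δ hδ
    obtain ⟨m, hm⟩ := (TopologicalSpace.denseRange_denseSeq A).exists_dist_lt y hδ
    refine ⟨d m, by rwa [← dist_eq_norm], ?_⟩
    filter_upwards [hν.eventually_gt_atTop m] with i hi
    exact Finset.mem_image_of_mem d (Finset.mem_range.2 hi)
  let B : ι → Type u := fun i => C (ν i)
  let a : A → FinPart U B := fun x =>
    FinPart.of (fun i => κ (ν i) x) ⟨‖x‖, Eventually.of_forall fun i => hle (ν i) x⟩
  have hmul : ∀ x y, (SeparationQuotient.mk (a (x * y)) : Hull U B) =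
      SeparationQuotient.mk (a x * a y) := by
    intro x y
    refine mk_eq_mk_of_eventually_le fun δ hδ => ?_
    -- Three errors of size `‖x‖ * δ'` must fit into `δ`; the `+ 1` in the denominator covers `x =
    -- 0`.
    obtain ⟨δ', hδ', hδx⟩ : ∃ δ' > 0, 3 * ‖x‖ * δ' ≤ δ := by
      refine ⟨δ / (3 * ‖x‖ + 1), by positivity, ?_⟩
      rw [mul_div_assoc', div_le_iff₀ (by positivity)]
      nlinarith [norm_nonneg x]
    obtain ⟨z, hz, hzi⟩ := happrox y δ' hδ'
    filter_upwards [hzi, hsmall δ' hδ'] with i hi1 hi2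
    change ‖κ (ν i) (x * y) - κ (ν i) x * κ (ν i) y‖ ≤ δ
    -- Replace `y` by a nearby `z` of the dense sequence; the two correction terms are small because
    -- the maps are contractive.
    have e : κ (ν i) (x * y) - κ (ν i) x * κ (ν i) y =
        (κ (ν i) (x * z) - κ (ν i) x * κ (ν i) z) + κ (ν i) (x * (y - z)) -
          κ (ν i) x * κ (ν i) (y - z) := by
      simp only [mul_sub, map_sub]
      abel
    rw [e]
    have b1 := (hF (ν i) z hi1).2 x
    have b2 : ‖κ (ν i) (x * (y - z))‖ ≤ ‖x‖ * δ' :=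
      (hle _ _).trans ((norm_mul_le _ _).trans
        (mul_le_mul_of_nonneg_left hz.le (norm_nonneg _)))
    have b3 : ‖κ (ν i) x * κ (ν i) (y - z)‖ ≤ ‖x‖ * δ' :=
      (norm_mul_le _ _).trans (mul_le_mul (hle _ _) ((hle _ _).trans hz.le) (norm_nonneg _)
        (norm_nonneg _))
    have b4 : ‖x‖ * (1 / (ν i + 1)) ≤ ‖x‖ * δ' := mul_le_mul_of_nonneg_left hi2 (norm_nonneg _)
    have b5 := norm_sub_le ((κ (ν i) (x * z) - κ (ν i) x * κ (ν i) z) + κ (ν i) (x * (y - z)))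
      (κ (ν i) x * κ (ν i) (y - z))
    have b6 := norm_add_le (κ (ν i) (x * z) - κ (ν i) x * κ (ν i) z) (κ (ν i) (x * (y - z)))
    linarith
  have hnorm : ∀ x, ‖x‖ ≤ ‖(SeparationQuotient.mk (a x) : Hull U B)‖ := by
    intro x
    rw [SeparationQuotient.norm_mk]
    refine le_of_forall_pos_le_add fun δ hδ => ?_
    rw [← sub_le_iff_le_add]
    -- One third each for `‖x‖ - ‖z‖`, for the norm loss at `z`, and for `‖κ z‖ - ‖κ x‖`.
    obtain ⟨z, hz, hzi⟩ := happrox x (δ / 3) (by positivity)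
    refine ge_of_tendsto (a x).tendsto_norm ?_
    filter_upwards [hzi, hsmall (δ / 3) (by positivity)] with i hi1 hi2
    change ‖x‖ - δ ≤ ‖κ (ν i) x‖
    have b1 := (hF (ν i) z hi1).1
    have b2 : ‖κ (ν i) z‖ - ‖κ (ν i) x‖ ≤ δ / 3 := by
      refine (norm_sub_norm_le _ _).trans ?_
      rw [← map_sub, ← norm_neg, ← map_neg, neg_sub]
      exact (hle _ _).trans hz.le
    have b3 := norm_sub_norm_le x z
    linarith
  let f : A →⋆ₐ[ℂ] Hull U B :=
    { toFun := fun x => SeparationQuotient.mk (a x)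
      map_one' := by
        refine congrArg SeparationQuotient.mk (Subtype.ext (funext fun i => hone _))
      map_zero' := by
        refine congrArg SeparationQuotient.mk (Subtype.ext (funext fun i => map_zero _))
      map_add' := fun x y => by
        refine congrArg SeparationQuotient.mk (Subtype.ext (funext fun i => map_add _ _ _))
      map_mul' := hmul
      commutes' := fun r => by
        refine congrArg SeparationQuotient.mk (Subtype.ext (funext fun i => ?_))
        change κ (ν i) (algebraMap ℂ A r) = algebraMap ℂ (C (ν i)) r
        rw [Algebra.algebraMap_eq_smul_one, map_smul, hone, Algebra.algebraMap_eq_smul_one]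
      map_star' := fun x => by
        refine congrArg SeparationQuotient.mk (Subtype.ext (funext fun i => hstar _ _)) }
  refine ⟨B, fun i => i1 (ν i), fun i => i2 (ν i), f, ?_⟩
  rw [injective_iff_map_eq_zero]
  intro x hx
  rw [← norm_le_zero_iff, ← norm_zero (E := Hull U B), ← hx]
  exact hnorm x

end Subhyperfinite

theorem mainTheorem2 {ι : Type v} (U : Ultrafilter ι)
    (hU : ∃ S : ℕ → Set ι, (∀ n, S n ∈ U) ∧ (⋂ n, S n) ∉ U)
    (A : Type u) [CStarAlgebra A] [PartialOrder A] [StarOrderedRing A]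
    [TopologicalSpace.SeparableSpace A] :
    (Subhyperfinite.IsNuclear A →
      (Subhyperfinite.IsSubhyperfinite U A ↔ Subhyperfinite.HasAlmostCommutingCompressions A)) ∧
    (Subhyperfinite.HasAlmostCommutingCompressions A → Subhyperfinite.IsSubhyperfinite U A) :=
  have h := Subhyperfinite.isSubhyperfinite_of_hasAlmostCommutingCompressions (A := A) U hU
  ⟨fun hA => ⟨Subhyperfinite.hasAlmostCommutingCompressions_of_isNuclear U hA, h⟩, h⟩
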